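/- **Setting.** Let $\mathsf X\subset\mathbb R^{d_x}$ and let $\mathbb F$ be a class of measurable functions $\mathsf X\to\mathbb R^{d_y}$ on which $\rho(f,g)=\|f-g\|_\infty=\sup_{x\in\mathsf X}\|f(x)-g(x)\|_2$ is finite, so that $(\mathbb F,\rho)$ is a metric space, and let $f_\star\in\mathbb F$. On a probability space let $y_t=f_\star(x_t)+w_t$ for $t=0,\dots,T-1$, where for an increasing sequence of $\sigma$-fields $(\mathcal F_t)_{t\ge-1}$ each $x_t\in\mathsf X$ is $\mathcal F_{t-1}$-measurable, each $w_t$ is $\mathcal F_t$-measurable with $\mathbf E[w_t\mid\mathcal F_{t-1}]=0$, and $w_t$ is conditionally $\sigma_w^2$-subgaussian given $\mathcal F_{t-1}$ ($\sigma_w\ge 0$). Here an integrable random vector $V$ is $\sigma^2$-subgaussian if $\mathbf E\exp(\lambda\langle V-\mathbf EV,s\rangle)\le\exp(\lambda^2\sigma^2/2)$ for all unit vectors $s$ and all $\lambda\in\mathbb R$, and conditionally subgaussian if this holds almost surely with conditional expectations. Let $P_\star$ be the law of $(x_0,\dots,x_{T-1},y_0,\dots,y_{T-1})$ and let $\sigma_T^2(\mathbb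 F,P_\star)$ be the infimum of all $\sigma^2\ge 0$ such that $\frac1T\sum_{t=0}^{T-1}\|f(x_t)-g(x_t)\|_2$ is $\sigma^2$-subgaussian under $P_\star$ for all $f,g\in\mathbb F$; assume that it is finite. Let $\mathcal N(\mathbb F,\|\cdot\|_\infty,\delta)$ be the least cardinality of a $\delta$-cover of $\mathbb F$ by elements of $\mathbb F$, with $\log\mathcal N=\infty$ if there is no finite cover. Let $\hat f$ be a (jointly measurable, possibly randomized) least squares estimator, $\hat f\in\arg\min_{f\in\mathbb F}\frac1T\sum_{t=0}^{T-1}\|y_t-f(x_t)\|_2^2$ almost surely, and let $\xi$ be independent of all other randomness, with law the uniform mixture of the laws of $x_0,\dots,x_{T-1}$. **Theorem (Parametric rates).** For every $C_0>0$ there is a constant $C>0$ depending only on $C_0$ such that the following holds. For all $d_y$, $\sigma_w\ge0$ and $\delta_0>0$ there is $T_0\in\mathbb N$ such that for all $T\ge T_0$, every setting as above, and all $p,c\ge 0$ with $$\log\mathcal N(\mathbb F,\|\cdot\|_\infty,\delta)\le C_0\,p\log\!\left(1+\frac c\delta\right)\qquad\text{for all }0<\delta\le\delta_0,$$ the variable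 $\|\hat f(\xi)-f_\star(\xi)\|_2$ is integrable and $$\mathbf E\|\hat f(\xi)-f_\star(\xi)\|_2\le C\left(\sqrt{\frac{\sigma_w^2\,p\log(1+c\sqrt{d_y}\,\sigma_wT^2)}{T}}+\sqrt{\sigma_T^2(\mathbb F,P_\star)\,p\log(1+cT)}+\frac1T\right).$$ -/

import Mathlib

open MeasureTheory
open scoped ENNReal NNReal UniformConvergence

noncomputable section

/-- An integrable random vector `V` is subgaussian with variance proxy `v` (the "`σ²`") under `μ`:
`𝔼 exp (l ⟨V - 𝔼 V, s⟩) ≤ exp (l² v / 2)` for all unit vectors `s` and all real `l`. -/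
def IsSubgaussian {Ω E : Type*} [MeasurableSpace Ω] [NormedAddCommGroup E]
    [InnerProductSpace ℝ E] (V : Ω → E) (v : ℝ) (μ : Measure Ω) : Prop :=
  Integrable V μ ∧ ∀ s : E, ‖s‖ = 1 → ∀ l : ℝ,
    Integrable (fun ω => Real.exp (l * inner ℝ (V ω - ∫ ω', V ω' ∂μ) s)) μ ∧
    ∫ ω, Real.exp (l * inner ℝ (V ω - ∫ ω', V ω' ∂μ) s) ∂μ ≤ Real.exp (l ^ 2 * v / 2)

/-- Conditional subgaussianity given the sub-σ-field `m`: the same definition with every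
expectation replaced by the conditional expectation given `m`. -/
def IsCondSubgaussian {Ω E : Type*} (m : MeasurableSpace Ω) {mΩ : MeasurableSpace Ω}
    [NormedAddCommGroup E] [InnerProductSpace ℝ E] [CompleteSpace E]
    (V : Ω → E) (v : ℝ) (μ : Measure Ω) : Prop :=
  Integrable V μ ∧ ∀ s : E, ‖s‖ = 1 → ∀ l : ℝ,
    Integrable (fun ω => Real.exp (l * inner ℝ (V ω - (μ[V|m]) ω) s)) μ ∧
    μ[fun ω => Real.exp (l * inner ℝ (V ω - (μ[V|m]) ω) s)|m]
      ≤ᵐ[μ] fun _ => Real.exp (l ^ 2 * v / 2)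

/-- The uniform (extended) distance `ρ(f, g) = sup_x ‖f x - g x‖`. -/
def uniformEDist {X E : Type*} [NormedAddCommGroup E] (f g : X → E) : ℝ≥0∞ :=
  edist (UniformFun.ofFun f) (UniformFun.ofFun g)

/-- Metric entropy `log 𝒩(F, ‖·‖_∞, δ)`: the logarithm of the least cardinality of a `δ`-cover of
`F` by elements of `F` in the uniform distance, and `⊤` if there is no finite cover. -/
def metricEntropy {X E : Type*} [NormedAddCommGroup E] (F : Set (X → E)) (δ : ℝ) : EReal :=
  ENNReal.log
    ((Metric.coveringNumber δ.toNNReal ((UniformFun.ofFun : (X → E) ≃ (X →ᵤ E)) '' F) : ℕ∞) : ℝ≥0∞)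

/-- The law `P_⋆` of the sample `Z = (x_0, …, x_{T-1}, y_0, …, y_{T-1})`. -/
def sampleLaw {Ω X E : Type*} [MeasurableSpace Ω] [MeasurableSpace X] [MeasurableSpace E] {T : ℕ}
    (μ : Measure Ω) (x : Fin T → Ω → X) (y : Fin T → Ω → E) :
    Measure ((Fin T → X) × (Fin T → E)) :=
  μ.map fun ω => (fun t => x t ω, fun t => y t ω)

/-- The set of all `v = σ² ≥ 0` such that `(1/T) ∑ₜ ‖f(x_t) - g(x_t)‖` is `v`-subgaussian under `P`
for all `f, g ∈ F`. -/
def subgaussianProxies {X E : Type*} [MeasurableSpace X] [MeasurableSpace E]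
    [NormedAddCommGroup E] {T : ℕ} (F : Set (X → E)) (P : Measure ((Fin T → X) × (Fin T → E))) :
    Set ℝ :=
  {v | 0 ≤ v ∧ ∀ f ∈ F, ∀ g ∈ F,
    IsSubgaussian (fun z => (1 / (T : ℝ)) * ∑ t, ‖f (z.1 t) - g (z.1 t)‖) v P}

/-- The variance proxy `σ_T²(F, P_⋆)`, the infimum of the above set (meaningful when that set is
nonempty, that is, when `F` is subgaussian with respect to the dynamics). -/
def varianceProxy {X E : Type*} [MeasurableSpace X] [MeasurableSpace E]
    [NormedAddCommGroup E] {T : ℕ} (F : Set (X → E)) (P : Measure ((Fin T → X) × (Fin T → E))) :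
    ℝ :=
  sInf (subgaussianProxies F P)

/-- The least squares estimates for the data `(x_t), (y_t)`: the minimizers over `F` of
`(1/T) ∑ₜ ‖y_t - f(x_t)‖²`. -/
def leastSquaresArgmin {X E : Type*} [NormedAddCommGroup E] {T : ℕ}
    (F : Set (X → E)) (x : Fin T → X) (y : Fin T → E) : Set (X → E) :=
  {f | f ∈ F ∧ ∀ g ∈ F,
    (1 / (T : ℝ)) * ∑ t, ‖y t - f (x t)‖ ^ 2 ≤ (1 / (T : ℝ)) * ∑ t, ‖y t - g (x t)‖ ^ 2}

/-- The uniform mixture `ν` of the laws of `x_0, …, x_{T-1}`. -/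
def covariateMixture {Ω X : Type*} [MeasurableSpace Ω] [MeasurableSpace X] {T : ℕ}
    (μ : Measure Ω) (x : Fin T → Ω → X) : Measure X :=
  (T : ℝ≥0∞)⁻¹ • ∑ t, μ.map (x t)

/-- The time-series model `y_t = f_⋆(x_t) + w_t`, `t = 0, …, T-1`, over a class `F` of measurable
functions which the uniform distance turns into a metric space.
The σ-field `𝓕 t` of the Lean filtration plays the role of `ℱ_{t-1}`, `t = 0, 1, …`. -/
structure IsTimeSeriesModel {Ω X E : Type*} [MeasurableSpace Ω] [MeasurableSpace X]
    [MeasurableSpace E] [NormedAddCommGroup E] [InnerProductSpace ℝ E] [CompleteSpace E] {T : ℕ}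
    (μ : Measure Ω) (𝓕 : Filtration ℕ ‹MeasurableSpace Ω›)
    (F : Set (X → E)) (fstar : X → E) (σw : ℝ)
    (x : Fin T → Ω → X) (y w : Fin T → Ω → E) : Prop where
  /-- the hypotheses are measurable functions -/
  measurable_of_mem : ∀ f ∈ F, Measurable f
  /-- the uniform distance is finite on `F` -/
  uniformEDist_ne_top : ∀ f ∈ F, ∀ g ∈ F, uniformEDist f g ≠ ⊤
  fstar_mem : fstar ∈ F
  /-- `x_t` is `ℱ_{t-1}`-measurable -/
  measurable_x : ∀ t : Fin T, Measurable[𝓕 t] (x t)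
  /-- `w_t` is `ℱ_t`-measurable -/
  measurable_w : ∀ t : Fin T, Measurable[𝓕 ((t : ℕ) + 1)] (w t)
  /-- `𝔼[w_t | ℱ_{t-1}] = 0` -/
  condExp_w : ∀ t : Fin T, μ[w t|𝓕 t] =ᵐ[μ] 0
  /-- `w_t` is conditionally `σ_w²`-subgaussian given `ℱ_{t-1}` -/
  condSubgaussian_w : ∀ t : Fin T, IsCondSubgaussian (𝓕 t) (w t) (σw ^ 2) μ
  y_eq : ∀ t ω, y t ω = fstar (x t ω) + w t ω

end

/-! The population risk is the empirical risk plus a deviation, and both are controlled by one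
device: if each of `N` variables has exponential moment at most one, any variable dominated
pointwise by one of them has mean at most `log N` (`integral_le_log_card_of_integral_exp_le_one`).

Empirical risk: least squares optimality bounds the squared error by a noise term minus a quadratic
penalty, read at the nearest point `g` of a finite cover
(`sum_norm_sub_sq_le_of_mem_leastSquaresArgmin`). For fixed `g` the direction `g(x_t) - f_⋆(x_t)` is
predictable, so the penalised noise, suitably scaled, is the logarithm of a supermartingale started
at one (`lintegral_exp_sum_inner_le_one`). The penalty compensates the variance exactly, which gives
the fast rate `σ_w² log N / T` for the mean squared error; a square root turns this into a bound on
the norm.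

Deviation: for fixed `g` the population risk is the mean of the empirical risk, and the variance
proxy controls its lower tail. A second cover, at scale `1/T`, makes this uniform
(`integral_residual_prod_le`). Dependence between covariates enters only through the proxy, so no
mixing is needed. -/

/-! ### Finite covers and boundedness of the class -/

theorem exists_finset_cover_of_metricEntropy_le {X E : Type*} [NormedAddCommGroup E]
    {F : Set (X → E)} {δ L : ℝ} (hδ : 0 ≤ δ) (hF : F.Nonempty)
    (h : metricEntropy F δ ≤ (L : EReal)) :
    ∃ s : Finset (X → E), s.Nonempty ∧ (∀ g ∈ s, g ∈ F) ∧ Real.log s.card ≤ L ∧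
      ∀ f ∈ F, ∃ g ∈ s, ∀ x, ‖f x - g x‖ ≤ δ := by
  classical
  unfold metricEntropy at h
  set A : Set (X →ᵤ E) := (UniformFun.ofFun : (X → E) ≃ (X →ᵤ E)) '' F
  have htop : Metric.coveringNumber δ.toNNReal A ≠ ⊤ := by
    intro htop
    rw [htop] at h
    simp at h
  obtain ⟨C, hCA, hCfin, hcov, hcard⟩ := Metric.exists_set_encard_eq_coveringNumber htop
  have hC : C.Nonempty := hcov.nonempty (hF.image _)
  lift C to Finset (X →ᵤ E) using hCfin
  refine ⟨C.image UniformFun.toFun, ?_, ?_, ?_, ?_⟩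
  · simpa using hC
  · intro g hg
    obtain ⟨c, hc, rfl⟩ := Finset.mem_image.1 hg
    obtain ⟨f, hf, rfl⟩ := hCA hc
    exact hf
  · rw [Finset.card_image_of_injective _ UniformFun.toFun.injective]
    rw [← hcard, Set.encard_coe_eq_coe_finsetCard] at h
    have hpos : (0 : ℝ) < C.card := by
      have : C.Nonempty := by simpa using hC
      exact_mod_cast this.card_pos
    have h2 : ENNReal.log (((C.card : ℕ∞) : ℝ≥0∞)) = ((Real.log C.card : ℝ) : EReal) := by
      rw [← ENNReal.log_ofReal_of_pos hpos]
      simp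
    rw [h2] at h
    exact_mod_cast h
  · intro f hf
    obtain ⟨c, hc, hfc⟩ := hcov (Set.mem_image_of_mem _ hf)
    refine ⟨UniformFun.toFun c, Finset.mem_image_of_mem _ hc, fun x => ?_⟩
    have h1 := (UniformFun.edist_le.1 hfc) x
    rw [edist_eq_enorm_sub, ← ofReal_norm] at h1
    have := ENNReal.toReal_mono (by simp) h1
    rw [ENNReal.toReal_ofReal (norm_nonneg _)] at this
    simpa [hδ] using this

theorem exists_norm_sub_le_of_uniformEDist_ne_top {X E : Type*} [NormedAddCommGroup E]
    {f g : X → E} (h : uniformEDist f g ≠ ⊤) : ∃ B : ℝ, ∀ x, ‖f x - g x‖ ≤ B := by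
  refine ⟨(uniformEDist f g).toReal, fun x => ?_⟩
  have h1 := (UniformFun.edist_le.1 (le_refl (uniformEDist f g))) x
  have := ENNReal.toReal_mono h h1
  rw [edist_eq_enorm_sub, toReal_enorm] at this
  simpa using this

/-- Finitely many balls whose centres lie at finite distance from `fstar`. The bound never enters
the rate; it supplies the integrability of all residuals. -/
theorem exists_bound_of_finset_cover {X E : Type*} [NormedAddCommGroup E]
    {F : Set (X → E)} {fstar : X → E} {δ : ℝ} {s : Finset (X → E)}
    (hs : ∀ g ∈ s, g ∈ F) (hcov : ∀ f ∈ F, ∃ g ∈ s, ∀ x, ‖f x - g x‖ ≤ δ)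
    (hfin : ∀ f ∈ F, ∀ g ∈ F, uniformEDist f g ≠ ⊤) (hstar : fstar ∈ F) :
    ∃ B : ℝ, 0 ≤ B ∧ ∀ f ∈ F, ∀ x, ‖f x - fstar x‖ ≤ B := by
  have h : ∀ g : X → E, ∃ B : ℝ, 0 ≤ B ∧ (g ∈ s → ∀ x, ‖g x - fstar x‖ ≤ B) := by
    intro g
    by_cases hg : g ∈ s
    · obtain ⟨B, hB⟩ := exists_norm_sub_le_of_uniformEDist_ne_top (hfin g (hs g hg) fstar hstar)
      exact ⟨max B 0, le_max_right _ _, fun _ x => (hB x).trans (le_max_left _ _)⟩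
    · exact ⟨0, le_rfl, fun h => absurd h hg⟩
  choose B hB0 hB using h
  have hsum : 0 ≤ ∑ g ∈ s, B g := Finset.sum_nonneg fun g _ => hB0 g
  refine ⟨|δ| + ∑ g ∈ s, B g, by positivity, fun f hf x => ?_⟩
  obtain ⟨g, hg, hfg⟩ := hcov f hf
  calc ‖f x - fstar x‖ = ‖(f x - g x) + (g x - fstar x)‖ := by abel_nf
    _ ≤ ‖f x - g x‖ + ‖g x - fstar x‖ := norm_add_le _ _
    _ ≤ |δ| + ∑ g ∈ s, B g := by
      gcongr
      · exact (hfg x).trans (le_abs_self _)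
      · exact (hB g hg x).trans (Finset.single_le_sum (f := B) (fun g _ => hB0 g) hg)

/-! ### Maxima of finitely many variables -/

/-- The exponential moment bound for a maximum of finitely many random variables. -/
theorem integral_le_log_card_of_integral_exp_le_one {Ω ι : Type*} [MeasurableSpace Ω]
    {μ : Measure Ω} [IsProbabilityMeasure μ] {s : Finset ι} (hs : s.Nonempty) {Y : Ω → ℝ}
    {Z : ι → Ω → ℝ} (hY : Integrable Y μ)
    (hZ : ∀ i ∈ s, Integrable (fun ω => Real.exp (Z i ω)) μ)
    (hZ1 : ∀ i ∈ s, ∫ ω, Real.exp (Z i ω) ∂μ ≤ 1)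
    (h : ∀ᵐ ω ∂μ, ∃ i ∈ s, Y ω ≤ Z i ω) :
    ∫ ω, Y ω ∂μ ≤ Real.log s.card := by
  have hpos : (0 : ℝ) < s.card := by exact_mod_cast hs.card_pos
  have hint : Integrable (fun ω => ∑ i ∈ s, Real.exp (Z i ω)) μ := integrable_finsetSum _ hZ
  calc ∫ ω, Y ω ∂μ
      ≤ ∫ ω, ((Real.log s.card - 1) + (s.card : ℝ)⁻¹ * ∑ i ∈ s, Real.exp (Z i ω)) ∂μ := by
        refine integral_mono_ae hY ((integrable_const _).add (hint.const_mul _)) ?_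
        filter_upwards [h] with ω hω
        obtain ⟨i, hi, hYi⟩ := hω
        -- The tangent to the logarithm at `N = s.card` gives `z ≤ log N - 1 + exp z / N`. Being
        -- linear in `exp z`, it lets the sum over `s` replace the maximum.
        have h1 := Real.add_one_le_exp (Z i ω - Real.log s.card)
        rw [Real.exp_sub, Real.exp_log hpos] at h1
        have h2 : Real.exp (Z i ω) ≤ ∑ i ∈ s, Real.exp (Z i ω) :=
          Finset.single_le_sum (f := fun i => Real.exp (Z i ω))
            (fun i _ => (Real.exp_pos _).le) hi
        have h3 : Real.exp (Z i ω) / s.card ≤ (s.card : ℝ)⁻¹ * ∑ i ∈ s, Real.exp (Z i ω) := by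
          rw [div_eq_inv_mul]
          gcongr
        linarith
    _ = (Real.log s.card - 1) + (s.card : ℝ)⁻¹ * ∑ i ∈ s, ∫ ω, Real.exp (Z i ω) ∂μ := by
        rw [integral_add (integrable_const _) (hint.const_mul _), integral_const_mul,
          integral_finsetSum _ hZ]
        simp
    _ ≤ (Real.log s.card - 1) + (s.card : ℝ)⁻¹ * ∑ i ∈ s, 1 := by
        gcongr with i hi
        exact hZ1 i hi
    _ = Real.log s.card := by
        simp [hpos.ne']

/-- For `a > 0` the quadratic `l² v / 2 - l a + L` is nonnegative for every real `l`, trivially so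
for `l ≤ 0`; hence its discriminant is nonpositive. This replaces the choice of an optimal `l` and
covers `v = 0`. -/
theorem le_sqrt_of_forall_mul_le {a v L : ℝ} (h : ∀ l : ℝ, 0 < l → l * a ≤ L + l ^ 2 * v / 2)
    (hL : 0 ≤ L) (hv : 0 ≤ v) : a ≤ Real.sqrt (2 * v * L) := by
  rcases le_or_gt a 0 with ha | ha
  · exact ha.trans (Real.sqrt_nonneg _)
  apply Real.le_sqrt_of_sq_le
  have := discrim_le_zero (a := v / 2) (b := -a) (c := L) fun l => by
    rcases le_or_gt l 0 with hl | hl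
    · have := mul_nonneg (neg_nonneg.2 hl) ha.le
      have := mul_nonneg hv (mul_self_nonneg l)
      nlinarith
    · have := h l hl
      nlinarith
  unfold discrim at this
  nlinarith

/-! ### Conditional subgaussianity in predictable directions -/

/-- Conditional subgaussianity of centred noise, tested against events and fixed directions. -/
theorem IsCondSubgaussian.setLIntegral_exp_inner_le {Ω E : Type*} {m m0 : MeasurableSpace Ω}
    [NormedAddCommGroup E] [InnerProductSpace ℝ E] [CompleteSpace E] {μ : Measure Ω}
    [IsFiniteMeasure μ]
    (hm : m ≤ m0) {w : Ω → E} {v : ℝ} (hw : IsCondSubgaussian m w v μ)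
    (h0 : μ[w|m] =ᵐ[μ] 0) (u : E) {A : Set Ω} (hA : MeasurableSet[m] A) :
    ∫⁻ ω in A, ENNReal.ofReal (Real.exp (inner ℝ (w ω) u - ‖u‖ ^ 2 * v / 2)) ∂μ ≤ μ A := by
  rcases eq_or_ne u 0 with rfl | hu
  · simp
  have hu' : ‖u‖ ≠ 0 := norm_ne_zero_iff.2 hu
  obtain ⟨hint, hexp⟩ := hw.2 (‖u‖⁻¹ • u) (by simp [norm_smul, hu']) ‖u‖
  have hae : (fun ω => Real.exp (‖u‖ * inner ℝ (w ω - (μ[w|m]) ω) (‖u‖⁻¹ • u)))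
      =ᵐ[μ] fun ω => Real.exp (inner ℝ (w ω) u) := by
    filter_upwards [h0] with ω hω
    rw [hω, inner_smul_right]
    simp [hu']
  have hint' : Integrable (fun ω => Real.exp (inner ℝ (w ω) u)) μ := hint.congr hae
  have hset : ∫ ω in A, Real.exp (inner ℝ (w ω) u) ∂μ ≤ Real.exp (‖u‖ ^ 2 * v / 2) * μ.real A := by
    rw [← setIntegral_condExp hm hint' hA]
    calc ∫ ω in A, (μ[fun ω => Real.exp (inner ℝ (w ω) u)|m]) ω ∂μ
        ≤ ∫ ω in A, Real.exp (‖u‖ ^ 2 * v / 2) ∂μ := by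
          refine setIntegral_mono_ae integrable_condExp.integrableOn
            (integrable_const _).integrableOn ?_
          filter_upwards [hexp, condExp_congr_ae (m := m) hae] with ω h1 h2
          rw [← h2]
          exact h1
      _ = Real.exp (‖u‖ ^ 2 * v / 2) * μ.real A := by
          simp [mul_comm]
  have hrw : ∀ ω, Real.exp (inner ℝ (w ω) u - ‖u‖ ^ 2 * v / 2)
      = Real.exp (-(‖u‖ ^ 2 * v / 2)) * Real.exp (inner ℝ (w ω) u) := by
    intro ω
    rw [← Real.exp_add]
    ring_nf
  simp_rw [hrw]
  rw [← ofReal_integral_eq_lintegral_ofReal (hint'.const_mul _).integrableOn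
    (Filter.Eventually.of_forall fun ω => by positivity), integral_const_mul]
  refine (ENNReal.ofReal_le_ofReal
    (mul_le_mul_of_nonneg_left hset (Real.exp_pos _).le)).trans_eq ?_
  rw [← mul_assoc, ← Real.exp_add, neg_add_cancel, Real.exp_zero, one_mul]
  exact ofReal_measureReal

/-- On each level set of `G`, which is an `m`-event, the direction is constant and the hypothesis
applies. -/
theorem setLIntegral_exp_inner_le_of_finite_range {Ω E : Type*} {m m0 : MeasurableSpace Ω}
    [NormedAddCommGroup E] [InnerProductSpace ℝ E] {μ : Measure Ω} (hm : m ≤ m0) {w : Ω → E} {v : ℝ}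
    (h : ∀ u : E, ∀ A, MeasurableSet[m] A →
      ∫⁻ ω in A, ENNReal.ofReal (Real.exp (inner ℝ (w ω) u - ‖u‖ ^ 2 * v / 2)) ∂μ ≤ μ A)
    {G : Ω → E} {R : Finset E} (hGR : ∀ ω, G ω ∈ R) (hG : ∀ u, MeasurableSet[m] (G ⁻¹' {u}))
    {A : Set Ω} (hA : MeasurableSet[m] A) :
    ∫⁻ ω in A, ENNReal.ofReal (Real.exp (inner ℝ (w ω) (G ω) - ‖G ω‖ ^ 2 * v / 2)) ∂μ ≤ μ A := by
  have hAeq : A = ⋃ u ∈ R, A ∩ G ⁻¹' {u} := by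
    ext ω
    simp [hGR]
  have hmeas : ∀ u, MeasurableSet[m] (A ∩ G ⁻¹' {u}) := fun u =>
    hA.inter (hG u)
  have hdisj : (R : Set E).PairwiseDisjoint fun u => A ∩ G ⁻¹' {u} := by
    intro u _ u' _ huu'
    refine Set.disjoint_left.2 fun ω h1 h2 => huu' ?_
    exact h1.2.symm.trans h2.2
  conv_lhs => rw [hAeq]
  rw [lintegral_biUnion_finset hdisj fun u _ => hm _ (hmeas u)]
  calc ∑ u ∈ R, ∫⁻ ω in A ∩ G ⁻¹' {u},
        ENNReal.ofReal (Real.exp (inner ℝ (w ω) (G ω) - ‖G ω‖ ^ 2 * v / 2)) ∂μ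
      ≤ ∑ u ∈ R, μ (A ∩ G ⁻¹' {u}) := by
        refine Finset.sum_le_sum fun u _ => ?_
        refine le_trans (le_of_eq ?_) (h u _ (hmeas u))
        refine setLIntegral_congr_fun (hm _ (hmeas u)) fun ω hω => ?_
        have : G ω = u := hω.2
        simp only [this]
    _ = μ A := by
        conv_rhs => rw [hAeq]
        rw [measure_biUnion_finset hdisj fun u _ => hm _ (hmeas u)]

section Predictable

variable {Ω E : Type*} {m m0 : MeasurableSpace Ω} [NormedAddCommGroup E]
  [InnerProductSpace ℝ E] [MeasurableSpace E] [BorelSpace E] [SecondCountableTopology E]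

theorem measurable_ofReal_exp_inner {w G : Ω → E} (v : ℝ) (hw : Measurable w) (hG : Measurable G) :
    Measurable fun ω => ENNReal.ofReal (Real.exp (inner ℝ (w ω) (G ω) - ‖G ω‖ ^ 2 * v / 2)) := by
  have := hw.inner (𝕜 := ℝ) hG
  fun_prop

/-- Approximation of `G` by `m`-measurable simple functions. Fatou's lemma suffices for the limit,
since the bound `μ A` does not depend on the approximation. -/
theorem setLIntegral_exp_inner_le {μ : Measure Ω} (hm : m ≤ m0) {w : Ω → E} (hw : Measurable w)
    {v : ℝ} (h : ∀ u : E, ∀ A, MeasurableSet[m] A →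
      ∫⁻ ω in A, ENNReal.ofReal (Real.exp (inner ℝ (w ω) u - ‖u‖ ^ 2 * v / 2)) ∂μ ≤ μ A)
    {G : Ω → E} (hG : Measurable[m] G) {A : Set Ω} (hA : MeasurableSet[m] A) :
    ∫⁻ ω in A, ENNReal.ofReal (Real.exp (inner ℝ (w ω) (G ω) - ‖G ω‖ ^ 2 * v / 2)) ∂μ ≤ μ A := by
  have hGs : StronglyMeasurable[m] G := hG.stronglyMeasurable
  have hlim : ∀ ω, Filter.Tendsto (fun n => ENNReal.ofReal
      (Real.exp (inner ℝ (w ω) (hGs.approx n ω) - ‖hGs.approx n ω‖ ^ 2 * v / 2))) Filter.atTop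
      (nhds (ENNReal.ofReal (Real.exp (inner ℝ (w ω) (G ω) - ‖G ω‖ ^ 2 * v / 2)))) := by
    intro ω
    have hc : Continuous fun u : E =>
        ENNReal.ofReal (Real.exp (inner ℝ (w ω) u - ‖u‖ ^ 2 * v / 2)) := by
      refine ENNReal.continuous_ofReal.comp ?_
      fun_prop
    exact (hc.tendsto _).comp (hGs.tendsto_approx ω)
  calc ∫⁻ ω in A, ENNReal.ofReal (Real.exp (inner ℝ (w ω) (G ω) - ‖G ω‖ ^ 2 * v / 2)) ∂μ
      = ∫⁻ ω in A, Filter.liminf (fun n => ENNReal.ofReal (Real.exp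
          (inner ℝ (w ω) (hGs.approx n ω) - ‖hGs.approx n ω‖ ^ 2 * v / 2))) Filter.atTop ∂μ := by
        refine lintegral_congr fun ω => ?_
        exact (hlim ω).liminf_eq.symm
    _ ≤ Filter.liminf (fun n => ∫⁻ ω in A, ENNReal.ofReal (Real.exp
          (inner ℝ (w ω) (hGs.approx n ω) - ‖hGs.approx n ω‖ ^ 2 * v / 2)) ∂μ) Filter.atTop := by
        refine lintegral_liminf_le fun n => measurable_ofReal_exp_inner v hw ?_
        exact (@SimpleFunc.measurable Ω E m _ (hGs.approx n)).mono hm le_rfl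
    _ ≤ μ A := by
        refine (Filter.liminf_le_liminf (Filter.Eventually.of_forall fun n =>
          setLIntegral_exp_inner_le_of_finite_range hm h
            (fun ω => (@SimpleFunc.mem_range_self Ω E m (hGs.approx n) ω))
            (fun u => @SimpleFunc.measurableSet_fiber Ω E m (hGs.approx n) u) hA)).trans ?_
        simp

/-- The bound over `m`-events says that the measure with density `φ` is dominated by `μ` on `m`;
integrating the `m`-measurable `H` preserves the comparison. With `H` the product of past factors,
this is the supermartingale step. -/
theorem lintegral_mul_exp_inner_le {μ : Measure Ω} (hm : m ≤ m0) {w : Ω → E} (hw : Measurable w)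
    {v : ℝ} (h : ∀ u : E, ∀ A, MeasurableSet[m] A →
      ∫⁻ ω in A, ENNReal.ofReal (Real.exp (inner ℝ (w ω) u - ‖u‖ ^ 2 * v / 2)) ∂μ ≤ μ A)
    {G : Ω → E} (hG : Measurable[m] G) {H : Ω → ℝ≥0∞} (hH : Measurable[m] H) :
    ∫⁻ ω, H ω * ENNReal.ofReal (Real.exp (inner ℝ (w ω) (G ω) - ‖G ω‖ ^ 2 * v / 2)) ∂μ
      ≤ ∫⁻ ω, H ω ∂μ := by
  set φ : Ω → ℝ≥0∞ := fun ω =>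
    ENNReal.ofReal (Real.exp (inner ℝ (w ω) (G ω) - ‖G ω‖ ^ 2 * v / 2))
  have hφ : Measurable φ := measurable_ofReal_exp_inner v hw (hG.mono hm le_rfl)
  have hle : (μ.withDensity φ).trim hm ≤ μ.trim hm := by
    refine Measure.le_iff.2 fun A hA => ?_
    rw [trim_measurableSet_eq hm hA, trim_measurableSet_eq hm hA, withDensity_apply _ (hm _ hA)]
    exact setLIntegral_exp_inner_le hm hw h hG hA
  calc ∫⁻ ω, H ω * φ ω ∂μ = ∫⁻ ω, (φ * H) ω ∂μ := by
        refine lintegral_congr fun ω => ?_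
        simp [mul_comm]
    _ = ∫⁻ ω, H ω ∂(μ.withDensity φ) :=
        (lintegral_withDensity_eq_lintegral_mul _ hφ (hH.mono hm le_rfl)).symm
    _ = ∫⁻ ω, H ω ∂((μ.withDensity φ).trim hm) := (lintegral_trim hm hH).symm
    _ ≤ ∫⁻ ω, H ω ∂(μ.trim hm) := lintegral_mono' hle le_rfl
    _ = ∫⁻ ω, H ω ∂μ := lintegral_trim hm hH

theorem IsCondSubgaussian.lintegral_mul_exp_inner_le [CompleteSpace E] {μ : Measure Ω}
    [IsFiniteMeasure μ]
    (hm : m ≤ m0) {w : Ω → E} {v : ℝ} (hw : IsCondSubgaussian m w v μ) (hwm : Measurable w)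
    (h0 : μ[w|m] =ᵐ[μ] 0) {G : Ω → E} (hG : Measurable[m] G) {H : Ω → ℝ≥0∞}
    (hH : Measurable[m] H) :
    ∫⁻ ω, H ω * ENNReal.ofReal (Real.exp (inner ℝ (w ω) (G ω) - ‖G ω‖ ^ 2 * v / 2)) ∂μ
      ≤ ∫⁻ ω, H ω ∂μ :=
  _root_.lintegral_mul_exp_inner_le hm hwm
    (fun u _ hA => hw.setLIntegral_exp_inner_le hm h0 u hA) hG hH

end Predictable

/-! ### Moments of the noise -/

theorem integrable_and_integral_le_one_of_lintegral {Ω : Type*} [MeasurableSpace Ω] {μ : Measure Ω}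
    {f : Ω → ℝ} (hf : Measurable f) (h0 : ∀ ω, 0 ≤ f ω)
    (h : ∫⁻ ω, ENNReal.ofReal (f ω) ∂μ ≤ 1) : Integrable f μ ∧ ∫ ω, f ω ∂μ ≤ 1 := by
  constructor
  · refine ⟨hf.aestronglyMeasurable, ?_⟩
    rw [hasFiniteIntegral_iff_ofReal (Filter.Eventually.of_forall h0)]
    exact h.trans_lt ENNReal.one_lt_top
  · rw [integral_eq_lintegral_of_nonneg_ae (Filter.Eventually.of_forall h0)
      hf.aestronglyMeasurable]
    exact ENNReal.toReal_mono ENNReal.one_ne_top h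

theorem integral_le_sqrt_integral_sq {Ω : Type*} [MeasurableSpace Ω] {μ : Measure Ω}
    [IsProbabilityMeasure μ] {f : Ω → ℝ} (hf : Integrable f μ)
    (hf2 : Integrable (fun ω => f ω ^ 2) μ) : ∫ ω, f ω ∂μ ≤ Real.sqrt (∫ ω, f ω ^ 2 ∂μ) := by
  apply Real.le_sqrt_of_sq_le
  set a := ∫ ω, f ω ∂μ with ha
  have h : ∫ ω, (2 * a * f ω - a ^ 2) ∂μ ≤ ∫ ω, f ω ^ 2 ∂μ :=
    integral_mono ((hf.const_mul _).sub (integrable_const _)) hf2 fun ω => by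
      nlinarith [sq_nonneg (f ω - a)]
  rw [integral_sub (hf.const_mul _) (integrable_const _), integral_const_mul, ← ha] at h
  simp at h
  nlinarith

theorem two_add_sq_le_exp_add_exp_neg (u : ℝ) : 2 + u ^ 2 ≤ Real.exp u + Real.exp (-u) := by
  have h1 : Real.cosh u = 1 + 2 * Real.sinh (u / 2) ^ 2 := by
    have := Real.cosh_two_mul (u / 2)
    rw [mul_div_cancel₀ u two_ne_zero, Real.cosh_sq] at this
    linarith
  have h2 : (u / 2) ^ 2 ≤ Real.sinh (u / 2) ^ 2 := by
    rcases le_total 0 (u / 2) with h | h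
    · have := Real.self_le_sinh_iff.2 h
      gcongr
    · have := Real.sinh_le_self_iff.2 h
      nlinarith
  have h3 := Real.cosh_eq u
  nlinarith

/-- The square is dominated by exponentials at `l` and `-l` through `u² ≤ exp u + exp (-u) - 2`. A
single value of `l` is enough because the constant 2 is not sharp. -/
theorem integrable_sq_and_integral_sq_le {Ω : Type*} [MeasurableSpace Ω] {μ : Measure Ω}
    [IsProbabilityMeasure μ] {f : Ω → ℝ} (hf : Measurable f) {σ : ℝ} (hσ : 0 ≤ σ)
    (h : ∀ l : ℝ, Integrable (fun ω => Real.exp (l * f ω)) μ ∧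
      ∫ ω, Real.exp (l * f ω) ∂μ ≤ Real.exp (l ^ 2 * σ ^ 2 / 2)) :
    Integrable (fun ω => f ω ^ 2) μ ∧ ∫ ω, f ω ^ 2 ∂μ ≤ 2 * σ ^ 2 := by
  have hle : ∀ l : ℝ, ∀ ω, (l * f ω) ^ 2 ≤
      Real.exp (l * f ω) + Real.exp (-l * f ω) - 2 := fun l ω => by
    have := two_add_sq_le_exp_add_exp_neg (l * f ω)
    rw [neg_mul]
    linarith
  have hint : ∀ l : ℝ, Integrable (fun ω => Real.exp (l * f ω) + Real.exp (-l * f ω) - 2) μ :=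
    fun l => ((h l).1.add (h (-l)).1).sub (integrable_const _)
  have hsq : Integrable (fun ω => f ω ^ 2) μ := by
    refine (hint 1).mono' (hf.pow_const 2).aestronglyMeasurable
      (Filter.Eventually.of_forall fun ω => ?_)
    have := hle 1 ω
    rw [Real.norm_of_nonneg (sq_nonneg _)]
    simpa using this
  refine ⟨hsq, ?_⟩
  have hmain : ∀ l : ℝ, l ^ 2 * ∫ ω, f ω ^ 2 ∂μ ≤ 2 * (Real.exp (l ^ 2 * σ ^ 2 / 2) - 1) := by
    intro l
    have h1 : ∫ ω, l ^ 2 * f ω ^ 2 ∂μ ≤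
        ∫ ω, (Real.exp (l * f ω) + Real.exp (-l * f ω) - 2) ∂μ :=
      integral_mono (hsq.const_mul _) (hint l) fun ω => by
        have := hle l ω
        rw [mul_pow] at this
        exact this
    have hadd : Integrable (fun ω => Real.exp (l * f ω) + Real.exp (-l * f ω)) μ :=
      (h l).1.add (h (-l)).1
    rw [integral_const_mul, integral_sub hadd (integrable_const _),
      integral_add (h l).1 (h (-l)).1] at h1
    have h2 := (h l).2
    have h3 := (h (-l)).2
    rw [neg_sq] at h3
    simp only [integral_const, probReal_univ, one_smul] at h1
    linarith
  rcases hσ.eq_or_lt with rfl | hσ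
  · have := hmain 1
    simpa using this
  -- At this `l` the right side is `2 (exp (1/2) - 1)`, and `exp (1/2) ≤ 2`.
  · have h1 := hmain σ⁻¹
    have h2 : σ⁻¹ ^ 2 * σ ^ 2 = 1 := by field_simp
    rw [h2] at h1
    have h3 : Real.exp (1 / 2) ≤ 2 := by
      have := Real.exp_bound_div_one_sub_of_interval (x := 1 / 2) (by norm_num) (by norm_num)
      norm_num at this ⊢
      linarith
    calc ∫ ω, f ω ^ 2 ∂μ = σ ^ 2 * (σ⁻¹ ^ 2 * ∫ ω, f ω ^ 2 ∂μ) := by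
          rw [← mul_assoc, mul_comm (σ ^ 2), h2, one_mul]
      _ ≤ σ ^ 2 * 2 := by
          gcongr
          linarith
      _ = 2 * σ ^ 2 := mul_comm _ _

theorem IsCondSubgaussian.integrable_exp_inner_and_integral_le {Ω E : Type*}
    {m m0 : MeasurableSpace Ω} [NormedAddCommGroup E] [InnerProductSpace ℝ E] [CompleteSpace E]
    [MeasurableSpace E] [BorelSpace E] [SecondCountableTopology E] {μ : Measure Ω}
    [IsProbabilityMeasure μ] (hm : m ≤ m0) {w : Ω → E} {v : ℝ} (hw : IsCondSubgaussian m w v μ)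
    (hwm : Measurable w) (h0 : μ[w|m] =ᵐ[μ] 0) (u : E) :
    Integrable (fun ω => Real.exp (inner ℝ (w ω) u)) μ ∧
      ∫ ω, Real.exp (inner ℝ (w ω) u) ∂μ ≤ Real.exp (‖u‖ ^ 2 * v / 2) := by
  have h1 := hw.setLIntegral_exp_inner_le hm h0 u (A := Set.univ) MeasurableSet.univ
  rw [Measure.restrict_univ, measure_univ] at h1
  have hmeas : Measurable fun ω => Real.exp (inner ℝ (w ω) u - ‖u‖ ^ 2 * v / 2) := by
    have := hwm.inner (𝕜 := ℝ) (measurable_const (a := u))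
    fun_prop
  obtain ⟨h2, h3⟩ := integrable_and_integral_le_one_of_lintegral hmeas
    (fun ω => (Real.exp_pos _).le) h1
  have heq : ∀ ω, Real.exp (inner ℝ (w ω) u) =
      Real.exp (‖u‖ ^ 2 * v / 2) * Real.exp (inner ℝ (w ω) u - ‖u‖ ^ 2 * v / 2) := fun ω => by
    rw [← Real.exp_add]
    ring_nf
  simp_rw [heq]
  refine ⟨h2.const_mul _, ?_⟩
  rw [integral_const_mul]
  exact mul_le_of_le_one_right (Real.exp_pos _).le h3

/-- Summing second moments over the `d` coordinates produces the factor `√d`, the source of `√d_y`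
inside the logarithm of the theorem. -/
theorem IsCondSubgaussian.integral_norm_le {Ω : Type*} {d : ℕ} {m m0 : MeasurableSpace Ω}
    {μ : Measure Ω} [IsProbabilityMeasure μ] (hm : m ≤ m0) {w : Ω → EuclideanSpace ℝ (Fin d)}
    {σ : ℝ} (hσ : 0 ≤ σ) (hw : IsCondSubgaussian m w (σ ^ 2) μ) (hwm : Measurable w)
    (h0 : μ[w|m] =ᵐ[μ] 0) : ∫ ω, ‖w ω‖ ∂μ ≤ 2 * (σ * Real.sqrt d) := by
  have hcoord : ∀ j : Fin d, Integrable (fun ω => w ω j ^ 2) μ ∧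
      ∫ ω, w ω j ^ 2 ∂μ ≤ 2 * σ ^ 2 := by
    intro j
    refine integrable_sq_and_integral_sq_le (by fun_prop) hσ fun l => ?_
    have := hw.integrable_exp_inner_and_integral_le hm hwm h0 (EuclideanSpace.single j l)
    simpa [EuclideanSpace.inner_single_right] using this
  have heq : ∀ ω, ‖w ω‖ ^ 2 = ∑ j, w ω j ^ 2 := fun ω => EuclideanSpace.real_norm_sq_eq _
  have hint : Integrable (fun ω => ‖w ω‖ ^ 2) μ := by
    simp_rw [heq]
    exact integrable_finsetSum _ fun j _ => (hcoord j).1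
  have hsq : ∫ ω, ‖w ω‖ ^ 2 ∂μ ≤ d * (2 * σ ^ 2) := by
    simp_rw [heq]
    rw [integral_finsetSum _ fun j _ => (hcoord j).1]
    refine (Finset.sum_le_sum fun j _ => (hcoord j).2).trans_eq ?_
    simp
  refine (integral_le_sqrt_integral_sq hw.1.norm hint).trans ?_
  rw [Real.sqrt_le_left (by positivity)]
  refine hsq.trans ?_
  rw [mul_pow, mul_pow, Real.sq_sqrt (by positivity)]
  nlinarith [mul_nonneg (sq_nonneg σ) (Nat.cast_nonneg (α := ℝ) d)]

/-! ### The basic inequality and the mixture law -/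

/-- The basic inequality of least squares, with the estimate replaced by a nearby function `g`. -/
theorem sum_norm_sub_sq_le_of_mem_leastSquaresArgmin {X E : Type*} [NormedAddCommGroup E]
    [InnerProductSpace ℝ E] {T : ℕ} (hT : 0 < T) {F : Set (X → E)} {f fstar g : X → E}
    {x : Fin T → X} {y w : Fin T → E} (hf : f ∈ leastSquaresArgmin F x y) (hstar : fstar ∈ F)
    (hy : ∀ t, y t = fstar (x t) + w t) {δ : ℝ} (hfg : ∀ z, ‖f z - g z‖ ≤ δ) :
    ∑ t, ‖f (x t) - fstar (x t)‖ ^ 2 ≤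
      ∑ t, (4 * inner ℝ (w t) (g (x t) - fstar (x t)) - ‖g (x t) - fstar (x t)‖ ^ 2 / 2)
        + 4 * δ * ∑ t, ‖w t‖ + T * δ ^ 2 := by
  have hT' : (0 : ℝ) < T := by exact_mod_cast hT
  have h1 : ∑ t, ‖y t - f (x t)‖ ^ 2 ≤ ∑ t, ‖y t - fstar (x t)‖ ^ 2 :=
    le_of_mul_le_mul_left (hf.2 fstar hstar) (by positivity)
  have h2 : ∀ t, ‖y t - f (x t)‖ ^ 2 = ‖w t‖ ^ 2 - 2 * inner ℝ (w t) (f (x t) - fstar (x t))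
      + ‖f (x t) - fstar (x t)‖ ^ 2 := fun t => by
    rw [← norm_sub_sq_real, hy]
    congr 2
    abel
  have h3 : ∀ t, ‖y t - fstar (x t)‖ ^ 2 = ‖w t‖ ^ 2 := fun t => by
    rw [hy]
    simp
  have h4 : ∑ t, ‖f (x t) - fstar (x t)‖ ^ 2 ≤
      2 * ∑ t, inner ℝ (w t) (f (x t) - fstar (x t)) := by
    simp_rw [h2, h3, Finset.sum_add_distrib, Finset.sum_sub_distrib, ← Finset.mul_sum] at h1
    linarith
  -- From `S ≤ 2A` follows `S ≤ 4A - S`, which creates the negative quadratic term. Replacing `f` by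
  -- `g` halves it, as `(a + δ)² ≤ 2a² + 2δ²`.
  have h5 : ∀ t, 4 * inner ℝ (w t) (f (x t) - fstar (x t)) - ‖f (x t) - fstar (x t)‖ ^ 2 ≤
      (4 * inner ℝ (w t) (g (x t) - fstar (x t)) - ‖g (x t) - fstar (x t)‖ ^ 2 / 2)
        + 4 * δ * ‖w t‖ + δ ^ 2 := by
    intro t
    have e : f (x t) - fstar (x t) = (g (x t) - fstar (x t)) + (f (x t) - g (x t)) := by abel
    have h6 : inner ℝ (w t) (f (x t) - fstar (x t)) ≤
        inner ℝ (w t) (g (x t) - fstar (x t)) + ‖w t‖ * δ := by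
      rw [e, inner_add_right]
      have := real_inner_le_norm (w t) (f (x t) - g (x t))
      have := mul_le_mul_of_nonneg_left (hfg (x t)) (norm_nonneg (w t))
      linarith
    have h7 : ‖g (x t) - fstar (x t)‖ ≤ ‖f (x t) - fstar (x t)‖ + δ := by
      have e' : g (x t) - fstar (x t) = (f (x t) - fstar (x t)) - (f (x t) - g (x t)) := by abel
      rw [e']
      exact (norm_sub_le _ _).trans (by gcongr; exact hfg _)
    have h8 : ‖g (x t) - fstar (x t)‖ ^ 2 ≤ (‖f (x t) - fstar (x t)‖ + δ) ^ 2 := by gcongr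
    nlinarith [sq_nonneg (‖f (x t) - fstar (x t)‖ - δ)]
  have h9 := Finset.sum_le_sum fun t (_ : t ∈ Finset.univ) => h5 t
  simp only [Finset.sum_add_distrib, Finset.sum_sub_distrib, ← Finset.mul_sum, Finset.sum_const,
    Finset.card_univ, Fintype.card_fin, nsmul_eq_mul] at h9 ⊢
  linarith

theorem integral_covariateMixture {Ω X : Type*} [MeasurableSpace Ω] [MeasurableSpace X] {T : ℕ}
    {μ : Measure Ω} {x : Fin T → Ω → X} (hx : ∀ t, Measurable (x t)) {h : X → ℝ}
    (hh : Measurable h) (hint : ∀ t, Integrable (fun ω => h (x t ω)) μ) :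
    ∫ z, h z ∂(covariateMixture μ x) = ∫ ω, (1 / (T : ℝ)) * ∑ t, h (x t ω) ∂μ := by
  unfold covariateMixture
  rw [integral_smul_measure, integral_finsetSum_measure, integral_const_mul,
    integral_finsetSum _ fun t _ => hint t]
  · simp only [ENNReal.toReal_inv, ENNReal.toReal_natCast, smul_eq_mul, one_div]
    congr 1
    exact Finset.sum_congr rfl fun t _ =>
      integral_map (hx t).aemeasurable hh.aestronglyMeasurable
  · intro t _
    exact (integrable_map_measure hh.aestronglyMeasurable (hx t).aemeasurable).2 (hint t)

theorem isProbabilityMeasure_covariateMixture {Ω X : Type*} [MeasurableSpace Ω]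
    [MeasurableSpace X] {T : ℕ} (hT : 0 < T) {μ : Measure Ω} [IsProbabilityMeasure μ]
    {x : Fin T → Ω → X} (hx : ∀ t, Measurable (x t)) :
    IsProbabilityMeasure (covariateMixture μ x) := by
  constructor
  have h : ∀ t, (μ.map (x t)) Set.univ = 1 := fun t => by
    rw [Measure.map_apply (hx t) MeasurableSet.univ]
    simp
  simp only [covariateMixture, Measure.smul_apply, Measure.finsetSum_apply, h]
  simp only [Finset.sum_const, Finset.card_univ, Fintype.card_fin, nsmul_eq_mul, mul_one,
    smul_eq_mul]
  exact ENNReal.inv_mul_cancel (by simpa using hT.ne') (ENNReal.natCast_ne_top T)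

/-! ### Empirical risk and deviation in the time-series model -/

namespace IsTimeSeriesModel

variable {Ω X E : Type*} [MeasurableSpace Ω] [MeasurableSpace X] [MeasurableSpace E]
  [NormedAddCommGroup E] [InnerProductSpace ℝ E] [CompleteSpace E] {T : ℕ} {μ : Measure Ω}
  {𝓕 : Filtration ℕ ‹MeasurableSpace Ω›} {F : Set (X → E)} {fstar : X → E} {σw : ℝ}
  {x : Fin T → Ω → X} {y w : Fin T → Ω → E}

theorem measurable_covariate (hM : IsTimeSeriesModel μ 𝓕 F fstar σw x y w) (t : Fin T) :
    Measurable (x t) := (hM.measurable_x t).mono (𝓕.le _) le_rfl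

theorem measurable_noise (hM : IsTimeSeriesModel μ 𝓕 F fstar σw x y w) (t : Fin T) :
    Measurable (w t) := (hM.measurable_w t).mono (𝓕.le _) le_rfl

theorem sum_sq_residual_eq_zero_of_noise_eq_zero (hM : IsTimeSeriesModel μ 𝓕 F fstar σw x y w)
    (hT : 0 < T) {f : X → E} {ω : Ω} (hw : ∀ t, w t ω = 0)
    (hf : f ∈ leastSquaresArgmin F (fun t => x t ω) (fun t => y t ω)) :
    ∑ t, ‖f (x t ω) - fstar (x t ω)‖ ^ 2 = 0 := by
  refine le_antisymm ?_ (Finset.sum_nonneg fun t _ => by positivity)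
  have h := sum_norm_sub_sq_le_of_mem_leastSquaresArgmin (g := f) (δ := 0) hT hf hM.fstar_mem
    (fun t => hM.y_eq t ω) (by simp)
  simp only [hw, inner_zero_left, mul_zero, zero_sub, Finset.sum_neg_distrib, norm_zero,
    Finset.sum_const_zero, add_zero, ← Finset.sum_div, zero_pow two_ne_zero] at h
  linarith

variable [BorelSpace E] [SecondCountableTopology E]

theorem measurable_response (hM : IsTimeSeriesModel μ 𝓕 F fstar σw x y w) (t : Fin T) :
    Measurable (y t) := by
  have : y t = fun ω => fstar (x t ω) + w t ω := funext fun ω => hM.y_eq t ω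
  rw [this]
  exact ((hM.measurable_of_mem _ hM.fstar_mem).comp (hM.measurable_covariate t)).add
    (hM.measurable_noise t)

theorem measurable_residual (hM : IsTimeSeriesModel μ 𝓕 F fstar σw x y w)
    {fhat : Ω → X → E} (hmeas : Measurable (Function.uncurry fhat)) (t : Fin T) :
    Measurable fun ω => ‖fhat ω (x t ω) - fstar (x t ω)‖ :=
  ((hmeas.comp (measurable_id.prodMk (hM.measurable_covariate t))).sub
    ((hM.measurable_of_mem _ hM.fstar_mem).comp (hM.measurable_covariate t))).norm

/-- The lower tail of the empirical distance of a fixed hypothesis. -/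
theorem integrable_exp_and_integral_le_of_mem_subgaussianProxies
    (hM : IsTimeSeriesModel μ 𝓕 F fstar σw x y w) {v : ℝ}
    (hv : v ∈ subgaussianProxies F (sampleLaw μ x y)) {g : X → E} (hg : g ∈ F) (l : ℝ) :
    Integrable (fun ω => Real.exp (l * ((∫ ω', (1 / (T : ℝ)) *
      ∑ t, ‖g (x t ω') - fstar (x t ω')‖ ∂μ) -
        (1 / (T : ℝ)) * ∑ t, ‖g (x t ω) - fstar (x t ω)‖))) μ ∧
    ∫ ω, Real.exp (l * ((∫ ω', (1 / (T : ℝ)) * ∑ t, ‖g (x t ω') - fstar (x t ω')‖ ∂μ) -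
        (1 / (T : ℝ)) * ∑ t, ‖g (x t ω) - fstar (x t ω)‖)) ∂μ ≤ Real.exp (l ^ 2 * v / 2) := by
  -- The unit vector `-1` of `ℝ` selects mean minus sample value.
  have hsub := (hv.2 g hg fstar hM.fstar_mem).2 (-1) (by simp) l
  have hpair : Measurable fun ω => ((fun t => x t ω, fun t => y t ω) : (Fin T → X) × (Fin T → E)) :=
    (measurable_pi_lambda _ hM.measurable_covariate).prodMk
      (measurable_pi_lambda _ hM.measurable_response)
  have hgm := hM.measurable_of_mem g hg
  have hsm := hM.measurable_of_mem _ hM.fstar_mem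
  have hV : Measurable fun z : (Fin T → X) × (Fin T → E) =>
      (1 / (T : ℝ)) * ∑ t, ‖g (z.1 t) - fstar (z.1 t)‖ := by
    refine (Finset.measurable_fun_sum _ fun t _ => ?_).const_mul _
    have h1 : Measurable fun z : (Fin T → X) × (Fin T → E) => z.1 t :=
      (measurable_pi_apply t).comp measurable_fst
    exact ((hgm.comp h1).sub (hsm.comp h1)).norm
  unfold sampleLaw at hsub
  rw [integral_map hpair.aemeasurable hV.aestronglyMeasurable] at hsub
  set a := ∫ ω', (1 / (T : ℝ)) * ∑ t, ‖g (x t ω') - fstar (x t ω')‖ ∂μ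
  have hexp : Measurable fun z : (Fin T → X) × (Fin T → E) => Real.exp (l * inner ℝ
      ((1 / (T : ℝ)) * ∑ t, ‖g (z.1 t) - fstar (z.1 t)‖ - a) (-1 : ℝ)) :=
    Real.measurable_exp.comp (((hV.sub_const a).inner measurable_const).const_mul l)
  rw [integral_map hpair.aemeasurable hexp.aestronglyMeasurable,
    integrable_map_measure hexp.aestronglyMeasurable hpair.aemeasurable] at hsub
  have heq : ∀ r : ℝ, inner ℝ (r - a) (-1 : ℝ) = a - r := fun r => by simp
  simpa only [heq, Function.comp_def] using hsub

variable [IsProbabilityMeasure μ]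

/-- The exponential is a product of factors, and the last one can be removed at no cost because the
earlier ones and its direction are known before the last noise. -/
theorem lintegral_exp_sum_inner_le_one (hM : IsTimeSeriesModel μ 𝓕 F fstar σw x y w)
    {G : Fin T → Ω → E} (hG : ∀ t : Fin T, Measurable[𝓕 t] (G t)) :
    ∫⁻ ω, ENNReal.ofReal
      (Real.exp (∑ t, (inner ℝ (w t ω) (G t ω) - ‖G t ω‖ ^ 2 * σw ^ 2 / 2))) ∂μ ≤ 1 := by
  -- Padding with the factor 1 beyond `T` lets the induction run over all of `ℕ`.
  set Y : ℕ → Ω → ℝ≥0∞ := fun n ω => if h : n < T then ENNReal.ofReal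
    (Real.exp (inner ℝ (w ⟨n, h⟩ ω) (G ⟨n, h⟩ ω) - ‖G ⟨n, h⟩ ω‖ ^ 2 * σw ^ 2 / 2)) else 1 with hYdef
  have hYm : ∀ n, Measurable[𝓕 (n + 1)] (Y n) := by
    intro n
    by_cases h : n < T
    · simp only [hYdef, h, dite_true]
      exact measurable_ofReal_exp_inner (m0 := 𝓕 (n + 1)) _ (hM.measurable_w ⟨n, h⟩)
        ((hG ⟨n, h⟩).mono (𝓕.mono (Nat.le_succ n)) le_rfl)
    · simp only [hYdef, h, dite_false]
      exact measurable_const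
  have hprod : ∀ k, ∫⁻ ω, ∏ n ∈ Finset.range k, Y n ω ∂μ ≤ 1 := by
    intro k
    induction k with
    | zero => simp
    | succ k ih =>
      simp_rw [Finset.prod_range_succ]
      by_cases h : k < T
      · refine le_trans ?_ ih
        have hH : Measurable[𝓕 k] fun ω => ∏ n ∈ Finset.range k, Y n ω := by
          refine @Finset.measurable_fun_prod _ _ _ _ _ _ (𝓕 k) _ _ fun n hn => ?_
          exact (hYm n).mono (𝓕.mono (Finset.mem_range.1 hn)) le_rfl
        have := (hM.condSubgaussian_w ⟨k, h⟩).lintegral_mul_exp_inner_le (𝓕.le k)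
          ((hM.measurable_w ⟨k, h⟩).mono (𝓕.le _) le_rfl) (hM.condExp_w ⟨k, h⟩) (hG ⟨k, h⟩) hH
        simpa only [hYdef, h, dite_true] using this
      · simpa only [hYdef, h, dite_false, mul_one] using ih
  refine le_trans (le_of_eq ?_) (hprod T)
  refine lintegral_congr fun ω => ?_
  rw [Finset.prod_range, Real.exp_sum, ENNReal.ofReal_prod_of_nonneg fun t _ => (Real.exp_pos _).le]
  refine Finset.prod_congr rfl fun t _ => ?_
  simp [hYdef]

theorem integrable_sum_sq_residual (hM : IsTimeSeriesModel μ 𝓕 F fstar σw x y w)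
    {fhat : Ω → X → E} (hmeas : Measurable (Function.uncurry fhat))
    (hF : ∀ᵐ ω ∂μ, fhat ω ∈ F) {B : ℝ} (hB : ∀ f ∈ F, ∀ z, ‖f z - fstar z‖ ≤ B) :
    Integrable (fun ω => ∑ t, ‖fhat ω (x t ω) - fstar (x t ω)‖ ^ 2) μ := by
  refine integrable_finsetSum _ fun t _ => ?_
  refine Integrable.of_bound ((hM.measurable_residual hmeas t).pow_const 2).aestronglyMeasurable
    (B ^ 2) ?_
  filter_upwards [hF] with ω hω
  rw [Real.norm_of_nonneg (by positivity)]
  have := hB _ hω (x t ω)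
  gcongr

theorem integrable_mean_residual (hM : IsTimeSeriesModel μ 𝓕 F fstar σw x y w)
    {fhat : Ω → X → E} (hmeas : Measurable (Function.uncurry fhat))
    (hF : ∀ᵐ ω ∂μ, fhat ω ∈ F) {B : ℝ} (hB : ∀ f ∈ F, ∀ z, ‖f z - fstar z‖ ≤ B) :
    Integrable (fun ω => (1 / (T : ℝ)) * ∑ t, ‖fhat ω (x t ω) - fstar (x t ω)‖) μ := by
  refine (integrable_finsetSum _ fun t _ => ?_).const_mul _
  refine Integrable.of_bound (hM.measurable_residual hmeas t).aestronglyMeasurable B ?_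
  filter_upwards [hF] with ω hω
  rw [norm_norm]
  exact hB _ hω (x t ω)

theorem integral_sum_sq_residual_le (hM : IsTimeSeriesModel μ 𝓕 F fstar σw x y w) (hT : 0 < T)
    (hσ : 0 < σw) {s : Finset (X → E)} (hs : s.Nonempty) (hsF : ∀ g ∈ s, g ∈ F) {δ : ℝ}
    (hcov : ∀ f ∈ F, ∃ g ∈ s, ∀ z, ‖f z - g z‖ ≤ δ)
    {B : ℝ} (hB : ∀ f ∈ F, ∀ z, ‖f z - fstar z‖ ≤ B)
    {fhat : Ω → X → E} (hmeas : Measurable (Function.uncurry fhat))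
    (hfhat : ∀ᵐ ω ∂μ, fhat ω ∈ leastSquaresArgmin F (fun t => x t ω) (fun t => y t ω)) :
    ∫ ω, ∑ t, ‖fhat ω (x t ω) - fstar (x t ω)‖ ^ 2 ∂μ ≤
      16 * σw ^ 2 * Real.log s.card + 4 * δ * ∑ t, ∫ ω, ‖w t ω‖ ∂μ + T * δ ^ 2 := by
  have hF : ∀ᵐ ω ∂μ, fhat ω ∈ F := hfhat.mono fun ω h => h.1
  have hSint := hM.integrable_sum_sq_residual hmeas hF hB
  have hwint : ∀ t ∈ Finset.univ, Integrable (fun ω => ‖w t ω‖) μ :=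
    fun t _ => (hM.condSubgaussian_w t).1.norm
  have hWint : Integrable (fun ω => ∑ t, ‖w t ω‖) μ := integrable_finsetSum _ hwint
  set Y : Ω → ℝ := fun ω => (16 * σw ^ 2)⁻¹ *
    (∑ t, ‖fhat ω (x t ω) - fstar (x t ω)‖ ^ 2 - 4 * δ * ∑ t, ‖w t ω‖ - T * δ ^ 2) with hY
  -- This scaling makes the compensated exponent equal to `(16 σw²)⁻¹` times the offset noise of the
  -- basic inequality.
  set G : (X → E) → Fin T → Ω → E := fun g t ω =>
    (4 * σw ^ 2)⁻¹ • (g (x t ω) - fstar (x t ω)) with hG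
  have hGm : ∀ g ∈ s, ∀ t : Fin T, Measurable[𝓕 t] (G g t) := fun g hg t =>
    (((hM.measurable_of_mem g (hsF g hg)).comp (hM.measurable_x t)).sub
      ((hM.measurable_of_mem _ hM.fstar_mem).comp (hM.measurable_x t))).const_smul _
  set Z : (X → E) → Ω → ℝ := fun g ω =>
    ∑ t, (inner ℝ (w t ω) (G g t ω) - ‖G g t ω‖ ^ 2 * σw ^ 2 / 2) with hZ
  have hexp : ∀ g ∈ s, Integrable (fun ω => Real.exp (Z g ω)) μ ∧
      ∫ ω, Real.exp (Z g ω) ∂μ ≤ 1 := by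
    intro g hg
    refine integrable_and_integral_le_one_of_lintegral ?_ (fun ω => (Real.exp_pos _).le)
      (hM.lintegral_exp_sum_inner_le_one (hGm g hg))
    refine Real.measurable_exp.comp (Finset.measurable_fun_sum _ fun t _ => ?_)
    have h1 : Measurable (G g t) := (hGm g hg t).mono (𝓕.le _) le_rfl
    have h2 := (hM.measurable_noise t).inner (𝕜 := ℝ) h1
    fun_prop
  have hYint : Integrable Y μ :=
    ((hSint.sub (hWint.const_mul _)).sub (integrable_const _)).const_mul _
  have key : ∫ ω, Y ω ∂μ ≤ Real.log s.card := by
    refine integral_le_log_card_of_integral_exp_le_one hs hYint (fun g hg => (hexp g hg).1)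
      (fun g hg => (hexp g hg).2) ?_
    filter_upwards [hfhat] with ω hω
    obtain ⟨g, hg, hfg⟩ := hcov _ hω.1
    refine ⟨g, hg, ?_⟩
    have h1 := sum_norm_sub_sq_le_of_mem_leastSquaresArgmin hT hω hM.fstar_mem
      (fun t => hM.y_eq t ω) hfg
    have h2 : Z g ω = (16 * σw ^ 2)⁻¹ * ∑ t, (4 * inner ℝ (w t ω) (g (x t ω) - fstar (x t ω))
        - ‖g (x t ω) - fstar (x t ω)‖ ^ 2 / 2) := by
      rw [Finset.mul_sum]
      refine Finset.sum_congr rfl fun t _ => ?_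
      simp only [hG, inner_smul_right, norm_smul, Real.norm_eq_abs, mul_pow, sq_abs]
      field_simp
      ring
    rw [h2]
    refine mul_le_mul_of_nonneg_left ?_ (by positivity)
    linarith
  have hYval : ∫ ω, Y ω ∂μ = (16 * σw ^ 2)⁻¹ *
      (∫ ω, ∑ t, ‖fhat ω (x t ω) - fstar (x t ω)‖ ^ 2 ∂μ - 4 * δ * ∑ t, ∫ ω, ‖w t ω‖ ∂μ
        - T * δ ^ 2) := by
    have hsub : Integrable (fun ω =>
        ∑ t, ‖fhat ω (x t ω) - fstar (x t ω)‖ ^ 2 - 4 * δ * ∑ t, ‖w t ω‖) μ :=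
      hSint.sub (hWint.const_mul _)
    simp only [hY]
    rw [integral_const_mul, integral_sub hsub (integrable_const _),
      integral_sub hSint (hWint.const_mul _), integral_const_mul, integral_finsetSum _ hwint]
    simp
  rw [hYval, inv_mul_le_iff₀ (by positivity)] at key
  linarith

theorem integral_mean_residual_le_sqrt (hM : IsTimeSeriesModel μ 𝓕 F fstar σw x y w) (hT : 0 < T)
    {fhat : Ω → X → E} (hmeas : Measurable (Function.uncurry fhat))
    (hF : ∀ᵐ ω ∂μ, fhat ω ∈ F) {B : ℝ} (hB : ∀ f ∈ F, ∀ z, ‖f z - fstar z‖ ≤ B) :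
    ∫ ω, (1 / (T : ℝ)) * ∑ t, ‖fhat ω (x t ω) - fstar (x t ω)‖ ∂μ ≤
      Real.sqrt ((∫ ω, ∑ t, ‖fhat ω (x t ω) - fstar (x t ω)‖ ^ 2 ∂μ) / T) := by
  have hT' : (0 : ℝ) < T := by exact_mod_cast hT
  have hle : ∀ ω, ((1 / (T : ℝ)) * ∑ t, ‖fhat ω (x t ω) - fstar (x t ω)‖) ^ 2 ≤
      (T : ℝ)⁻¹ * ∑ t, ‖fhat ω (x t ω) - fstar (x t ω)‖ ^ 2 := by
    intro ω
    have := sq_sum_le_card_mul_sum_sq (s := (Finset.univ : Finset (Fin T)))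
      (f := fun t => ‖fhat ω (x t ω) - fstar (x t ω)‖)
    rw [Finset.card_univ, Fintype.card_fin] at this
    rw [mul_pow]
    calc (1 / (T : ℝ)) ^ 2 * (∑ t, ‖fhat ω (x t ω) - fstar (x t ω)‖) ^ 2
        ≤ (1 / (T : ℝ)) ^ 2 * (T * ∑ t, ‖fhat ω (x t ω) - fstar (x t ω)‖ ^ 2) := by gcongr
      _ = _ := by field_simp
  have hm := hM.integrable_mean_residual hmeas hF hB
  have hS := hM.integrable_sum_sq_residual hmeas hF hB
  have hm2 : Integrable
      (fun ω => ((1 / (T : ℝ)) * ∑ t, ‖fhat ω (x t ω) - fstar (x t ω)‖) ^ 2) μ := by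
    refine (hS.const_mul (T : ℝ)⁻¹).mono' (hm.aestronglyMeasurable.pow 2)
      (Filter.Eventually.of_forall fun ω => ?_)
    rw [Real.norm_of_nonneg (by positivity)]
    exact hle ω
  refine (integral_le_sqrt_integral_sq hm hm2).trans (Real.sqrt_le_sqrt ?_)
  exact (integral_mono hm2 (hS.const_mul _) hle).trans_eq
    (by rw [integral_const_mul, div_eq_inv_mul])

theorem integrable_residual_prod (hM : IsTimeSeriesModel μ 𝓕 F fstar σw x y w)
    {ν : Measure X} [IsProbabilityMeasure ν]
    {fhat : Ω → X → E} (hmeas : Measurable (Function.uncurry fhat))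
    (hF : ∀ᵐ ω ∂μ, fhat ω ∈ F) {B : ℝ} (hB : ∀ f ∈ F, ∀ z, ‖f z - fstar z‖ ≤ B) :
    Integrable (fun q : Ω × X => ‖fhat q.1 q.2 - fstar q.2‖) (μ.prod ν) := by
  refine Integrable.of_bound (C := B) ?_ ?_
  · exact (hmeas.sub ((hM.measurable_of_mem _ hM.fstar_mem).comp
      measurable_snd)).norm.aestronglyMeasurable
  · filter_upwards [Measure.quasiMeasurePreserving_fst.ae hF] with q hq
    rw [norm_norm]
    exact hB _ hq _

/-- Passing from the empirical to the population risk, uniformly over the hypotheses. -/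
theorem integral_residual_prod_le (hM : IsTimeSeriesModel μ 𝓕 F fstar σw x y w) (hT : 0 < T)
    {s : Finset (X → E)} (hs : s.Nonempty) (hsF : ∀ g ∈ s, g ∈ F) {δ : ℝ}
    (hcov : ∀ f ∈ F, ∃ g ∈ s, ∀ z, ‖f z - g z‖ ≤ δ)
    {B : ℝ} (hB : ∀ f ∈ F, ∀ z, ‖f z - fstar z‖ ≤ B)
    {fhat : Ω → X → E} (hmeas : Measurable (Function.uncurry fhat))
    (hF : ∀ᵐ ω ∂μ, fhat ω ∈ F) {v : ℝ} (hv : v ∈ subgaussianProxies F (sampleLaw μ x y)) :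
    ∫ q : Ω × X, ‖fhat q.1 q.2 - fstar q.2‖ ∂(μ.prod (covariateMixture μ x)) ≤
      (∫ ω, (1 / (T : ℝ)) * ∑ t, ‖fhat ω (x t ω) - fstar (x t ω)‖ ∂μ) + 2 * δ
        + Real.sqrt (2 * v * Real.log s.card) := by
  have hT' : (0 : ℝ) < T := by exact_mod_cast hT
  have := isProbabilityMeasure_covariateMixture hT (μ := μ) hM.measurable_covariate
  set ν := covariateMixture μ x with hν
  have hint := hM.integrable_residual_prod (ν := ν) hmeas hF hB
  have hPint := hint.integral_prod_left
  have hm := hM.integrable_mean_residual hmeas hF hB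
  rw [integral_prod _ hint]
  set P : Ω → ℝ := fun ω => ∫ z, ‖fhat ω z - fstar z‖ ∂ν
  set e : Ω → ℝ := fun ω => (1 / (T : ℝ)) * ∑ t, ‖fhat ω (x t ω) - fstar (x t ω)‖
  set eg : (X → E) → Ω → ℝ := fun g ω => (1 / (T : ℝ)) * ∑ t, ‖g (x t ω) - fstar (x t ω)‖
  suffices h : ∫ ω, P ω ∂μ - ∫ ω, e ω ∂μ - 2 * δ ≤ Real.sqrt (2 * v * Real.log s.card) by
    change ∫ ω, P ω ∂μ ≤ _
    linarith
  have hcard : (1 : ℝ) ≤ s.card := by exact_mod_cast hs.card_pos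
  refine le_sqrt_of_forall_mul_le (fun l hl => ?_) (Real.log_nonneg hcard) hv.1
  have hsm := hM.measurable_of_mem _ hM.fstar_mem
  have hpop : ∀ g ∈ F, ∫ z, ‖g z - fstar z‖ ∂ν = ∫ ω, eg g ω ∂μ := by
    intro g hg
    have hgm : Measurable fun z => ‖g z - fstar z‖ := ((hM.measurable_of_mem g hg).sub hsm).norm
    refine integral_covariateMixture hM.measurable_covariate hgm fun t => ?_
    refine Integrable.of_bound (hgm.comp (hM.measurable_covariate t)).aestronglyMeasurable B ?_
    exact Filter.Eventually.of_forall fun ω => by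
      rw [norm_norm]
      exact hB g hg _
  have hres : ∀ g ∈ F, Integrable (fun z => ‖g z - fstar z‖) ν := by
    intro g hg
    refine Integrable.of_bound
      ((hM.measurable_of_mem g hg).sub hsm).norm.aestronglyMeasurable B ?_
    exact Filter.Eventually.of_forall fun z => by
      rw [norm_norm]
      exact hB g hg _
  -- Subtracting `l² v / 2` normalises each exponential moment to at most one. The `2δ` pays for
  -- moving to `g` once in the population risk and once in the empirical risk.
  have key : ∫ ω, (l * (P ω - e ω - 2 * δ) - l ^ 2 * v / 2) ∂μ ≤ Real.log s.card := by
    refine integral_le_log_card_of_integral_exp_le_one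
      (Z := fun g ω => l * ((∫ ω', eg g ω' ∂μ) - eg g ω) - l ^ 2 * v / 2) hs ?_ ?_ ?_ ?_
    · exact ((((hPint.sub hm).sub (integrable_const _))).const_mul _).sub (integrable_const _)
    · intro g hg
      simp_rw [Real.exp_sub]
      exact (hM.integrable_exp_and_integral_le_of_mem_subgaussianProxies hv
        (hsF g hg) l).1.div_const _
    · intro g hg
      simp_rw [Real.exp_sub]
      rw [integral_div, div_le_one (Real.exp_pos _)]
      exact (hM.integrable_exp_and_integral_le_of_mem_subgaussianProxies hv (hsF g hg) l).2
    · filter_upwards [hF] with ω hω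
      obtain ⟨g, hg, hfg⟩ := hcov _ hω
      refine ⟨g, hg, ?_⟩
      have h1 : P ω ≤ (∫ ω', eg g ω' ∂μ) + δ := by
        rw [← hpop g (hsF g hg)]
        calc P ω ≤ ∫ z, (‖g z - fstar z‖ + δ) ∂ν := by
              refine integral_mono (hres _ hω) ((hres g (hsF g hg)).add (integrable_const _))
                fun z => ?_
              have e1 : fhat ω z - fstar z = (g z - fstar z) + (fhat ω z - g z) := by abel
              simp only [e1]
              exact (norm_add_le _ _).trans (by gcongr; exact hfg z)
          _ = _ := by
              rw [integral_add (hres g (hsF g hg)) (integrable_const _)]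
              simp
      have h2 : eg g ω ≤ e ω + δ := by
        have h3 : ∑ t, ‖g (x t ω) - fstar (x t ω)‖ ≤
            ∑ t, (‖fhat ω (x t ω) - fstar (x t ω)‖ + δ) := by
          refine Finset.sum_le_sum fun t _ => ?_
          have e1 : g (x t ω) - fstar (x t ω) =
            (fhat ω (x t ω) - fstar (x t ω)) - (fhat ω (x t ω) - g (x t ω)) := by abel
          rw [e1]
          exact (norm_sub_le _ _).trans (by gcongr; exact hfg _)
        have h4 := mul_le_mul_of_nonneg_left h3 (by positivity : 0 ≤ 1 / (T : ℝ))
        rw [Finset.sum_add_distrib, mul_add, Finset.sum_const, Finset.card_univ, Fintype.card_fin,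
          nsmul_eq_mul, ← mul_assoc (1 / (T : ℝ)) T δ, one_div_mul_cancel hT'.ne', one_mul] at h4
        exact h4
      have : l * (P ω - e ω - 2 * δ) ≤ l * ((∫ ω', eg g ω' ∂μ) - eg g ω) := by
        refine mul_le_mul_of_nonneg_left ?_ hl.le
        linarith
      simpa using this
  have hsub1 : Integrable (fun ω => P ω - e ω) μ := hPint.sub hm
  have hsub2 : Integrable (fun ω => l * (P ω - e ω - 2 * δ)) μ :=
    (hsub1.sub (integrable_const _)).const_mul _
  rw [integral_sub hsub2 (integrable_const _), integral_const_mul,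
    integral_sub hsub1 (integrable_const _), integral_sub hPint hm] at key
  simp only [integral_const, probReal_univ, one_smul] at key
  linarith

end IsTimeSeriesModel

/-! ### Choice of scales and conclusion -/

/-- The infimum is attained: the moment bound is continuous in the proxy, so it passes to the limit
along a minimising sequence. -/
theorem varianceProxy_mem_subgaussianProxies {X E : Type*} [MeasurableSpace X] [MeasurableSpace E]
    [NormedAddCommGroup E] {T : ℕ} {F : Set (X → E)} {P : Measure ((Fin T → X) × (Fin T → E))}
    (h : (subgaussianProxies F P).Nonempty) : varianceProxy F P ∈ subgaussianProxies F P := by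
  have hbdd : BddBelow (subgaussianProxies F P) := ⟨0, fun v hv => hv.1⟩
  obtain ⟨u, -, hlim, hu⟩ := exists_seq_tendsto_sInf h hbdd
  refine ⟨Real.sInf_nonneg fun v hv => hv.1, fun f hf g hg => ?_⟩
  obtain ⟨v, hv⟩ := h
  refine ⟨(hv.2 f hf g hg).1, fun s hs l => ⟨((hv.2 f hf g hg).2 s hs l).1, ?_⟩⟩
  have hc : Continuous fun r : ℝ => Real.exp (l ^ 2 * r / 2) := by fun_prop
  exact ge_of_tendsto' ((hc.tendsto _).comp hlim) fun n => (((hu n).2 f hf g hg).2 s hs l).2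

theorem IsTimeSeriesModel.integral_sum_sq_residual_eq_zero {Ω X E : Type*} [MeasurableSpace Ω]
    [MeasurableSpace X] [MeasurableSpace E] [NormedAddCommGroup E] [InnerProductSpace ℝ E]
    [CompleteSpace E] {T : ℕ} {μ : Measure Ω} {𝓕 : Filtration ℕ ‹MeasurableSpace Ω›}
    {F : Set (X → E)} {fstar : X → E} {σw : ℝ} {x : Fin T → Ω → X} {y w : Fin T → Ω → E}
    (hM : IsTimeSeriesModel μ 𝓕 F fstar σw x y w) (hT : 0 < T)
    (hw : ∀ t, ∫ ω, ‖w t ω‖ ∂μ ≤ 0) {fhat : Ω → X → E}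
    (hfhat : ∀ᵐ ω ∂μ, fhat ω ∈ leastSquaresArgmin F (fun t => x t ω) (fun t => y t ω)) :
    ∫ ω, ∑ t, ‖fhat ω (x t ω) - fstar (x t ω)‖ ^ 2 ∂μ = 0 := by
  have hw0 : ∀ᵐ ω ∂μ, ∀ t, w t ω = 0 := by
    refine ae_all_iff.2 fun t => ?_
    have h0 : ∫ ω, ‖w t ω‖ ∂μ = 0 :=
      le_antisymm (hw t) (integral_nonneg fun ω => norm_nonneg _)
    rw [integral_eq_zero_iff_of_nonneg (fun ω => norm_nonneg _)
      (hM.condSubgaussian_w t).1.norm] at h0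
    filter_upwards [h0] with ω hω
    simpa using hω
  rw [integral_eq_zero_of_ae]
  filter_upwards [hw0, hfhat] with ω h1 h2
  exact hM.sum_sq_residual_eq_zero_of_noise_eq_zero hT h1 h2

/-- The empirical risk of least squares over a class of parametric complexity. -/
theorem IsTimeSeriesModel.integral_mean_residual_le {Ω X : Type*} [MeasurableSpace Ω]
    [MeasurableSpace X] {d T : ℕ} {μ : Measure Ω} [IsProbabilityMeasure μ]
    {𝓕 : Filtration ℕ ‹MeasurableSpace Ω›}
    {F : Set (X → EuclideanSpace ℝ (Fin d))} {fstar : X → EuclideanSpace ℝ (Fin d)} {σw : ℝ}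
    {x : Fin T → Ω → X} {y w : Fin T → Ω → EuclideanSpace ℝ (Fin d)}
    (hM : IsTimeSeriesModel μ 𝓕 F fstar σw x y w) (hT : 0 < T) (hσ : 0 ≤ σw)
    {C₀ p c δ₀ : ℝ} (hC₀ : 0 ≤ C₀)
    (hent : ∀ δ : ℝ, 0 < δ → δ ≤ δ₀ →
      metricEntropy F δ ≤ ((C₀ * (p * Real.log (1 + c / δ)) : ℝ) : EReal))
    (hT1 : 0 < σw * Real.sqrt d → 1 ≤ σw * Real.sqrt d * T)
    (hT2 : 0 < σw * Real.sqrt d → 1 ≤ σw * Real.sqrt d * δ₀ * T)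
    {B : ℝ} (hB : ∀ f ∈ F, ∀ z, ‖f z - fstar z‖ ≤ B)
    {fhat : Ω → X → EuclideanSpace ℝ (Fin d)} (hmeas : Measurable (Function.uncurry fhat))
    (hfhat : ∀ᵐ ω ∂μ, fhat ω ∈ leastSquaresArgmin F (fun t => x t ω) (fun t => y t ω)) :
    ∫ ω, (1 / (T : ℝ)) * ∑ t, ‖fhat ω (x t ω) - fstar (x t ω)‖ ∂μ ≤
      4 * Real.sqrt C₀ *
        Real.sqrt (σw ^ 2 * p * Real.log (1 + c * Real.sqrt d * σw * (T : ℝ) ^ 2) / T)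
      + 3 * (1 / T) := by
  have hT' : (1 : ℝ) ≤ T := by exact_mod_cast hT
  have hT0 : (0 : ℝ) < T := by linarith
  have hF : ∀ᵐ ω ∂μ, fhat ω ∈ F := hfhat.mono fun ω h => h.1
  have hnoise : ∀ t, ∫ ω, ‖w t ω‖ ∂μ ≤ 2 * (σw * Real.sqrt d) := fun t =>
    (hM.condSubgaussian_w t).integral_norm_le (𝓕.le _) hσ (hM.measurable_noise t) (hM.condExp_w t)
  refine (hM.integral_mean_residual_le_sqrt hT hmeas hF hB).trans ?_
  set a := σw * Real.sqrt d with ha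
  have ha0 : 0 ≤ a := by positivity
  -- If `a = 0` the noise vanishes almost surely; this case is separate because the scale below
  -- divides by `a`.
  rcases ha0.eq_or_lt with ha0 | ha0
  · rw [hM.integral_sum_sq_residual_eq_zero hT (fun t => (hnoise t).trans_eq (by simp [← ha0]))
      hfhat]
    simp only [zero_div, Real.sqrt_zero]
    positivity
  have hσ0 : 0 < σw := pos_of_mul_pos_left ha0 (Real.sqrt_nonneg _)
  -- At `δ = 1/(a T²)` the noise cost is `4δ · T · 2a = 8/T`, and `T δ² ≤ 1/T`. Dividing the total
  -- `9/T` by `T` gives `(3/T)²`.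
  have hδpos : 0 < 1 / (a * (T : ℝ) ^ 2) := by positivity
  have haT := hT1 ha0
  have hδT : 1 / (a * (T : ℝ) ^ 2) ≤ 1 / T := by
    refine one_div_le_one_div_of_le hT0 ?_
    nlinarith
  have hδ₀ : 1 / (a * (T : ℝ) ^ 2) ≤ δ₀ := by
    rw [div_le_iff₀ (by positivity)]
    nlinarith [hT2 ha0]
  obtain ⟨s, hs, hsF, hcard, hcov⟩ := exists_finset_cover_of_metricEntropy_le hδpos.le
    ⟨fstar, hM.fstar_mem⟩ (hent _ hδpos hδ₀)
  have hmain := hM.integral_sum_sq_residual_le hT hσ0 hs hsF hcov hB hmeas hfhat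
  set δ := 1 / (a * (T : ℝ) ^ 2) with hδ
  have hlog : 1 + c / δ = 1 + c * Real.sqrt d * σw * (T : ℝ) ^ 2 := by
    rw [hδ, ha]
    simp only [one_div, div_inv_eq_mul]
    ring
  rw [hlog] at hcard
  set L := Real.log (1 + c * Real.sqrt d * σw * (T : ℝ) ^ 2)
  have hsum : ∑ t, ∫ ω, ‖w t ω‖ ∂μ ≤ T * (2 * a) := by
    refine (Finset.sum_le_sum fun t _ => hnoise t).trans_eq ?_
    simp
  -- No signs of `p` and `c` are assumed here; a nonempty cover forces nonnegativity.
  have hpL : 0 ≤ C₀ * (p * L) := by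
    refine le_trans (Real.log_nonneg ?_) hcard
    exact_mod_cast hs.card_pos
  have h1 : (∫ ω, ∑ t, ‖fhat ω (x t ω) - fstar (x t ω)‖ ^ 2 ∂μ) / T ≤
      16 * (C₀ * (σw ^ 2 * p * L / T)) + (3 * (1 / T)) ^ 2 := by
    rw [div_le_iff₀ hT0]
    have h2 : 4 * δ * ∑ t, ∫ ω, ‖w t ω‖ ∂μ ≤ 4 * δ * (T * (2 * a)) := by gcongr
    have h3 : 4 * δ * (T * (2 * a)) = 8 * (1 / T) := by
      rw [hδ]
      field_simp
      norm_num
    have h4 : T * δ ^ 2 ≤ T * (1 / T) ^ 2 := by gcongr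
    have h5 : (T : ℝ) * (1 / T) ^ 2 = 1 / T := by field_simp
    have h6 : 16 * σw ^ 2 * Real.log s.card ≤ 16 * σw ^ 2 * (C₀ * (p * L)) := by gcongr
    have h7 : (16 * (C₀ * (σw ^ 2 * p * L / T)) + (3 * (1 / T)) ^ 2) * T =
        16 * σw ^ 2 * (C₀ * (p * L)) + 9 * (1 / T) := by
      field_simp
      ring
    rw [h7]
    linarith
  have hq : 0 ≤ 16 * (C₀ * (σw ^ 2 * p * L / T)) := by
    have : 16 * (C₀ * (σw ^ 2 * p * L / T)) = 16 * σw ^ 2 / T * (C₀ * (p * L)) := by ring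
    rw [this]
    positivity
  calc Real.sqrt ((∫ ω, ∑ t, ‖fhat ω (x t ω) - fstar (x t ω)‖ ^ 2 ∂μ) / T)
      ≤ Real.sqrt (16 * (C₀ * (σw ^ 2 * p * L / T)) + (3 * (1 / T)) ^ 2) := Real.sqrt_le_sqrt h1
    _ ≤ Real.sqrt (16 * (C₀ * (σw ^ 2 * p * L / T))) + Real.sqrt ((3 * (1 / T)) ^ 2) :=
        Real.sqrt_le_iff.2 ⟨by positivity, by
          rw [add_sq, Real.sq_sqrt hq, Real.sq_sqrt (sq_nonneg _)]
          have := mul_nonneg (Real.sqrt_nonneg (16 * (C₀ * (σw ^ 2 * p * L / T))))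
            (Real.sqrt_nonneg ((3 * (1 / (T : ℝ))) ^ 2))
          linarith⟩
    _ = 4 * Real.sqrt C₀ * Real.sqrt (σw ^ 2 * p * L / T) + 3 * (1 / T) := by
        rw [Real.sqrt_sq (by positivity), Real.sqrt_mul (by norm_num), Real.sqrt_mul hC₀,
          show (16 : ℝ) = 4 ^ 2 by norm_num, Real.sqrt_sq (by norm_num)]
        ring

/-- Constants: `C` depends only on the implicit constant `C₀` of the entropy bound, and the
threshold `T₀` only on `C₀`, the range `δ₀` of the entropy bound, `d_y` and `σ_w`. The expectation
is over `(ω, ξ)` drawn from `μ ⊗ ν`, i.e. `ξ ∼ ν` is independent of all other randomness. -/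
theorem theorem3 :
    ∀ C₀ : ℝ, 0 < C₀ → ∃ C : ℝ, 0 < C ∧
    ∀ (dy : ℕ) (σw δ₀ : ℝ), 0 ≤ σw → 0 < δ₀ → ∃ T₀ : ℕ, ∀ T : ℕ, T₀ ≤ T →
    ∀ (dx : ℕ) (X : Set (EuclideanSpace ℝ (Fin dx)))
      (F : Set (X → EuclideanSpace ℝ (Fin dy))) (p c : ℝ), 0 ≤ p → 0 ≤ c →
      (∀ δ : ℝ, 0 < δ → δ ≤ δ₀ →
        metricEntropy F δ ≤ ((C₀ * (p * Real.log (1 + c / δ)) : ℝ) : EReal)) →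
    ∀ {Ω : Type*} [MeasurableSpace Ω] (μ : Measure Ω) [IsProbabilityMeasure μ]
      (𝓕 : Filtration ℕ ‹MeasurableSpace Ω›)
      (fstar : X → EuclideanSpace ℝ (Fin dy))
      (x : Fin T → Ω → X) (y w : Fin T → Ω → EuclideanSpace ℝ (Fin dy)),
      IsTimeSeriesModel μ 𝓕 F fstar σw x y w →
      (subgaussianProxies F (sampleLaw μ x y)).Nonempty →
    ∀ (fhat : Ω → X → EuclideanSpace ℝ (Fin dy)),
      Measurable (Function.uncurry fhat) →
      (∀ᵐ ω ∂μ, fhat ω ∈ leastSquaresArgmin F (fun t => x t ω) (fun t => y t ω)) →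
      Integrable (fun q : Ω × X => ‖fhat q.1 q.2 - fstar q.2‖)
          (μ.prod (covariateMixture μ x)) ∧
        ∫ q : Ω × X, ‖fhat q.1 q.2 - fstar q.2‖ ∂(μ.prod (covariateMixture μ x)) ≤
          C * (Real.sqrt (σw ^ 2 * p * Real.log (1 + c * Real.sqrt dy * σw * (T : ℝ) ^ 2) / T)
            + Real.sqrt (varianceProxy F (sampleLaw μ x y) * p * Real.log (1 + c * T))
            + 1 / T) := by
  intro C₀ hC₀
  -- `4√C₀` comes from the noise and `√(2C₀)` from the deviation; `5 = 3 + 2` collects the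
  -- discretisation errors of the two covers.
  refine ⟨4 * Real.sqrt C₀ + Real.sqrt (2 * C₀) + 5, by positivity, fun dy σw δ₀ hσ hδ₀ => ?_⟩
  set a := σw * Real.sqrt dy with ha
  -- The entries give, in order, `T > 0`, `1/T ≤ δ₀`, `1/(a T²) ≤ 1/T` and `1/(a T²) ≤ δ₀`. If `a =
  -- 0` the last two are zero by the division convention and impose nothing.
  refine ⟨max 1 (max ⌈1 / δ₀⌉₊ (max ⌈1 / a⌉₊ ⌈1 / (a * δ₀)⌉₊)), ?_⟩
  intro T hT dx X F p c hp hc hent Ω _ μ _ 𝓕 fstar x y w hM hv fhat hmeas hfhat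
  simp only [max_le_iff, Nat.ceil_le] at hT
  obtain ⟨hT1, hTδ, hTa, hTaδ⟩ := hT
  have hT' : (1 : ℝ) ≤ T := by exact_mod_cast hT1
  have hT0 : (0 : ℝ) < T := by linarith
  have hF : ∀ᵐ ω ∂μ, fhat ω ∈ F := hfhat.mono fun ω h => h.1
  have hδT : 1 / (T : ℝ) ≤ δ₀ := by
    rw [div_le_iff₀ hδ₀] at hTδ
    rw [div_le_iff₀ hT0]
    linarith
  obtain ⟨s, hs, hsF, hcard, hcov⟩ := exists_finset_cover_of_metricEntropy_le
    (one_div_pos.2 hT0).le ⟨fstar, hM.fstar_mem⟩ (hent _ (one_div_pos.2 hT0) hδT)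
  obtain ⟨B, -, hB⟩ := exists_bound_of_finset_cover hsF hcov hM.uniformEDist_ne_top hM.fstar_mem
  have := isProbabilityMeasure_covariateMixture hT1 (μ := μ) hM.measurable_covariate
  refine ⟨hM.integrable_residual_prod hmeas hF hB, ?_⟩
  have hproxy := varianceProxy_mem_subgaussianProxies hv
  have hemp := hM.integral_mean_residual_le hT1 hσ hC₀.le hent
    (fun h => by rwa [div_le_iff₀ h, mul_comm] at hTa)
    (fun h => by rwa [div_le_iff₀ (mul_pos h hδ₀), mul_comm] at hTaδ) hB hmeas hfhat
  have hpop := hM.integral_residual_prod_le hT1 hs hsF hcov hB hmeas hF hproxy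
  set V := varianceProxy F (sampleLaw μ x y)
  have hV : 0 ≤ V := hproxy.1
  set Q := Real.sqrt (σw ^ 2 * p * Real.log (1 + c * Real.sqrt dy * σw * (T : ℝ) ^ 2) / T)
  have hQ : 0 ≤ Q := Real.sqrt_nonneg _
  have hroot : Real.sqrt (2 * V * Real.log s.card) ≤
      Real.sqrt (2 * C₀) * Real.sqrt (V * p * Real.log (1 + c * T)) := by
    rw [← Real.sqrt_mul (by positivity)]
    refine Real.sqrt_le_sqrt ?_
    have hcT : c / (1 / (T : ℝ)) = c * T := by simp
    rw [hcT] at hcard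
    calc 2 * V * Real.log s.card ≤ 2 * V * (C₀ * (p * Real.log (1 + c * T))) := by gcongr
      _ = 2 * C₀ * (V * p * Real.log (1 + c * T)) := by ring
  set R := Real.sqrt (V * p * Real.log (1 + c * T))
  have hR : 0 ≤ R := Real.sqrt_nonneg _
  have h1 : 0 ≤ Real.sqrt C₀ := Real.sqrt_nonneg _
  have h2 : 0 ≤ Real.sqrt (2 * C₀) := Real.sqrt_nonneg _
  have h3 : 0 ≤ 1 / (T : ℝ) := by positivity
  refine hpop.trans ?_
  have expand : (4 * Real.sqrt C₀ + Real.sqrt (2 * C₀) + 5) * (Q + R + 1 / T) =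
      (4 * Real.sqrt C₀ * Q + 3 * (1 / T)) + 2 * (1 / T) + Real.sqrt (2 * C₀) * R
      + ((Real.sqrt (2 * C₀) + 5) * Q + (4 * Real.sqrt C₀ + 5) * R
        + (4 * Real.sqrt C₀ + Real.sqrt (2 * C₀)) * (1 / T)) := by ring
  rw [expand]
  have hrest : 0 ≤ (Real.sqrt (2 * C₀) + 5) * Q + (4 * Real.sqrt C₀ + 5) * R
      + (4 * Real.sqrt C₀ + Real.sqrt (2 * C₀)) * (1 / T) := by positivity
  linarith
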